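/- Notation. For $\psi\in L^2(\mathbb R)$ let $\hat\psi$ be its Fourier transform, normalized by $\hat\psi(\xi)=\int_{\mathbb R} e^{-2\pi i\xi x}\psi(x)\,dx$ for $\psi\in L^1\cap L^2$, and let the affine system of $\psi$ be $\psi_{m,z}(x)=2^{m/2}\psi(2^m x-z)$, $(m,z)\in\mathbb Z\times\mathbb Z$. Call $\psi$ a normalized tight frame wavelet if $\sum_{m,z}|\langle f,\psi_{m,z}\rangle|^2=\|f\|^2$ for all $f\in L^2(\mathbb R)$. Two affine frames $(\psi_{m,z})$, $(\phi_{m,z})$ are strongly disjoint if the ranges of their analysis operators $f\mapsto(\langle f,\psi_{m,z}\rangle)_{m,z}$ and $f\mapsto(\langle f,\phi_{m,z}\rangle)_{m,z}$ are orthogonal in $\ell^2(\mathbb Z\times\mathbb Z)$. Proposition. There is a normalized tight frame wavelet $\psi_0\in L^2(\mathbb R)$ of Frazier–Jawerth type, that is, such that $\hat\psi_0$ is $C^\infty$, vanishes outside $[-\frac12,-\frac18)\cup[\frac18,\frac12)$, and satisfies $$\sum_{j\in\mathbb Z}|\hat\psi_0(2^j\xi)|^2=1\quad(\xi\ne0),\qquad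 \sum_{j\ge0}\hat\psi_0(2^j\xi)\overline{\hat\psi_0(2^j(\xi+q))}=0\quad(\xi\in\mathbb R,\ q\in\mathbb Z\text{ odd}),$$ with the following property: for every integer $N\ge0$, the functions $\psi_1,\dots,\psi_N\in L^2(\mathbb R)$ defined by $\hat\psi_n(\xi)=\hat\psi_0(4^n\xi)$ are normalized tight frame wavelets with $C^\infty$, compactly supported Fourier transforms, and their affine frames are pairwise strongly disjoint. In particular, for every $N$ there exist $N$ normalized tight frame wavelets with smooth, compactly supported Fourier transforms whose affine frames are pairwise strongly disjoint. -/

import Mathlib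

open MeasureTheory FourierTransform
open scoped ENNReal ContDiff ComplexConjugate

noncomputable section

namespace WaveletFrames

section Frames

variable {J H K : Type*} [NormedAddCommGroup H] [InnerProductSpace ℂ H]
  [NormedAddCommGroup K] [InnerProductSpace ℂ K]

/-- `(x j)` is a Bessel sequence: `∑ j, |⟨f, x j⟩|² ≤ C ‖f‖²` for all `f`, for some finite `C`.
(Mathlib's `inner ℂ u v` is conjugate-linear in `u`, so `⟨f, x j⟩` is `inner ℂ (x j) f`.) -/
def IsBessel (x : J → H) : Prop :=
  ∃ C : ℝ, ∀ f : H, Summable (fun j => ‖inner ℂ (x j) f‖ ^ 2) ∧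
    ∑' j, ‖inner ℂ (x j) f‖ ^ 2 ≤ C * ‖f‖ ^ 2

/-- `(x j)` is a normalized tight frame (frame with both bounds equal to one). -/
def IsNormalizedTightFrame (x : J → H) : Prop :=
  ∀ f : H, HasSum (fun j => ‖inner ℂ (x j) f‖ ^ 2) (‖f‖ ^ 2)

theorem IsNormalizedTightFrame.isBessel {x : J → H} (hx : IsNormalizedTightFrame x) :
    IsBessel x :=
  ⟨1, fun f => ⟨(hx f).summable, by rw [(hx f).tsum_eq, one_mul]⟩⟩

theorem IsBessel.memℓp {x : J → H} (hx : IsBessel x) (f : H) :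
    Memℓp (fun j => inner ℂ (x j) f) (2 : ℝ≥0∞) := by
  obtain ⟨C, hC⟩ := hx
  refine memℓp_gen ?_
  simpa using (hC f).1

/-- The analysis operator `f ↦ (⟨f, x j⟩)_j` of a Bessel sequence, with values in `ℓ²(J)`. -/
def analysisOperator (x : J → H) (hx : IsBessel x) :
    H →ₗ[ℂ] lp (fun _ : J => ℂ) 2 where
  toFun f := ⟨fun j => inner ℂ (x j) f, hx.memℓp f⟩
  map_add' f g := by
    ext j
    exact inner_add_right _ _ _
  map_smul' c f := by
    ext j
    exact inner_smul_right _ _ _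

/-- Two Bessel sequences (in particular two frames) over the same index set are strongly disjoint
if the ranges of their analysis operators are orthogonal subspaces of `ℓ²(J)`. -/
def StronglyDisjoint (x : J → H) (y : J → K) : Prop :=
  ∃ (hx : IsBessel x) (hy : IsBessel y),
    LinearMap.range (analysisOperator x hx) ⟂ LinearMap.range (analysisOperator y hy)

end Frames

/-- The Hilbert space `L²(ℝ)`. -/
abbrev L2R : Type := Lp ℂ 2 (volume : Measure ℝ)

/-- Translation `(T_α f)(x) = f (x - α)` on `L²(ℝ)`. -/
def translation (α : ℝ) (f : L2R) : L2R :=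
  Lp.compMeasurePreserving (fun x : ℝ => x - α) (measurePreserving_sub_right volume α) f

theorem memLp_dilation {a : ℝ} (ha : a ≠ 0) (f : L2R) :
    MemLp (fun x : ℝ => (Real.sqrt |a| : ℂ) * f (a * x)) 2 volume := by
  have h : MemLp f 2 (Measure.map (fun x : ℝ => a * x) volume) := by
    rw [Real.map_volume_mul_left ha]
    exact (Lp.memLp f).smul_measure ENNReal.ofReal_ne_top
  exact (h.comp_of_map (measurable_const_mul a).aemeasurable).const_mul _

/-- Dilation `(D_a f)(x) = √|a| f (a x)` on `L²(ℝ)`, for `a ≠ 0`. -/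
def dilation (a : ℝ) (ha : a ≠ 0) (f : L2R) : L2R := (memLp_dilation ha f).toLp _

/-- The dyadic affine system `D_{2^m} T_z ψ`, i.e. `x ↦ 2^{m/2} ψ (2^m x - z)`,
indexed by `(m, z) ∈ ℤ × ℤ`. -/
def affineSystem (ψ : L2R) : ℤ × ℤ → L2R := fun p =>
  dilation ((2 : ℝ) ^ p.1) (zpow_ne_zero _ two_ne_zero) (translation (p.2 : ℝ) ψ)

/-- `ψ` is a normalized tight frame wavelet for `L²(ℝ)`. -/
def IsNormalizedTightFrameWavelet (ψ : L2R) : Prop :=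
  IsNormalizedTightFrame (affineSystem ψ)

/-- The (Plancherel) Fourier transform of `ψ` is (a.e. equal to) a smooth function with compact
support. -/
def HasSmoothCompactFourier (ψ : L2R) : Prop :=
  ∃ g : ℝ → ℂ, ContDiff ℝ ∞ g ∧ HasCompactSupport g ∧ (𝓕 ψ : L2R) =ᵐ[volume] g

/-- Functions `g` on the frequency side of Frazier-Jawerth type: smooth, supported in
`[-1/2, -1/8) ∪ [1/8, 1/2)`, and satisfying the two equations below. -/
structure IsFrazierJawerth (g : ℝ → ℂ) : Prop where
  smooth : ContDiff ℝ ∞ g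
  support_subset : Function.support g ⊆ Set.Ico (-(1 / 2)) (-(1 / 8)) ∪ Set.Ico (1 / 8) (1 / 2)
  sum_sq : ∀ ξ : ℝ, ξ ≠ 0 → HasSum (fun j : ℤ => ‖g ((2 : ℝ) ^ j * ξ)‖ ^ 2) 1
  sum_odd : ∀ (ξ : ℝ) (q : ℤ), Odd q →
    HasSum (fun j : ℕ => g ((2 : ℝ) ^ j * ξ) * conj (g ((2 : ℝ) ^ j * (ξ + q)))) 0

end WaveletFrames

end

namespace WaveletFrames

/-! By Plancherel, the coefficients of `f` at scale `T = 2 ^ m` are Fourier coefficients of `𝓕 f`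
times the conjugate of `h (ξ / T)`, where `h` is the Fourier transform of the wavelet. If `h` is
supported in one period `(-1/2, 1/2]`, there is no aliasing: Parseval gives the energy at each
scale, and the dyadic square sum of `h` adds these energies to `‖f‖ ^ 2`
(`isNormalizedTightFrameWavelet_fourierInvOfTest`). If two such `h` have disjoint supports,
polarized Parseval makes their coefficient sequences orthogonal at every scale
(`stronglyDisjoint_affineSystem_fourierInvOfTest`).

It remains to find a window supported in `1/8 < |ξ| < 7/16`. Since `7/16 < 1/2`, the odd-shift
equation holds term by term; since the endpoints have ratio `7/2 < 4`, dilation by distinct powers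
of `4` separates supports. -/

noncomputable section

/-! ### The smooth window and its dyadic square sum -/

/-- A smooth even angle function, equal to `π / 2` on `[-1/4, 1/4]` and to `0` outside
`(-7/16, 7/16)`. -/
def windowAngle (ξ : ℝ) : ℝ :=
  -- The quotient is `1` at `|ξ| = 1/4` and `0` at `|ξ| = 7/16`; using `ξ ^ 2` avoids the corner of
  -- `|ξ|` at `0`.
  Real.pi / 2 * Real.smoothTransition ((49 - 256 * ξ ^ 2) / 33)

theorem windowAngle_of_abs_le {ξ : ℝ} (h : |ξ| ≤ 1 / 4) : windowAngle ξ = Real.pi / 2 := by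
  have : ξ ^ 2 ≤ (1 / 4) ^ 2 := sq_le_sq' (abs_le.1 h).1 (abs_le.1 h).2
  rw [windowAngle, Real.smoothTransition.one_of_one_le (by linarith), mul_one]

theorem windowAngle_of_le_abs {ξ : ℝ} (h : 7 / 16 ≤ |ξ|) : windowAngle ξ = 0 := by
  have : (7 / 16) ^ 2 ≤ ξ ^ 2 := by
    rw [← sq_abs ξ]
    exact pow_le_pow_left₀ (by norm_num) h 2
  rw [windowAngle, Real.smoothTransition.zero_of_nonpos (by linarith), mul_zero]

theorem contDiff_windowAngle : ContDiff ℝ ∞ windowAngle := by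
  have h : ContDiff ℝ ∞ Real.smoothTransition := Real.smoothTransition.contDiff
  exact contDiff_const.mul (h.comp (by fun_prop))

/-- A real smooth function supported in `1/8 < |ξ| < 7/16` whose dyadic dilates have squares
summing to one. -/
def realWindow (ξ : ℝ) : ℝ :=
  Real.sin (windowAngle ξ) * Real.cos (windowAngle (2 * ξ))

/-- `realWindow` as a complex-valued function. -/
def window (ξ : ℝ) : ℂ := (realWindow ξ : ℂ)

theorem realWindow_of_abs_le {ξ : ℝ} (h : |ξ| ≤ 1 / 8) : realWindow ξ = 0 := by
  rw [realWindow, windowAngle_of_abs_le (ξ := 2 * ξ), Real.cos_pi_div_two, mul_zero]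
  rw [abs_mul, abs_two]
  linarith

theorem realWindow_of_le_abs {ξ : ℝ} (h : 7 / 16 ≤ |ξ|) : realWindow ξ = 0 := by
  rw [realWindow, windowAngle_of_le_abs h, Real.sin_zero, zero_mul]

/-- The angle is `π / 2` at `ξ` and `0` at `4 * ξ`, so only the cosine and sine of the angle at `2 *
ξ` survive. -/
theorem realWindow_sq_add {ξ : ℝ} (h₁ : 1 / 8 < |ξ|) (h₂ : |ξ| ≤ 1 / 4) :
    realWindow ξ ^ 2 + realWindow (2 * ξ) ^ 2 = 1 := by
  have h₃ : 7 / 16 ≤ |2 * (2 * ξ)| := by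
    rw [abs_mul, abs_mul, abs_two]
    linarith
  rw [realWindow, realWindow, windowAngle_of_abs_le h₂, windowAngle_of_le_abs h₃,
    Real.sin_pi_div_two, Real.cos_zero, one_mul, mul_one, Real.cos_sq_add_sin_sq]

theorem abs_mem_of_window_ne_zero {ξ : ℝ} (h : window ξ ≠ 0) : 1 / 8 < |ξ| ∧ |ξ| < 7 / 16 := by
  have h' : realWindow ξ ≠ 0 := fun h0 => h (by rw [window, h0, Complex.ofReal_zero])
  exact ⟨lt_of_not_ge fun h0 => h' (realWindow_of_abs_le h0),
    lt_of_not_ge fun h0 => h' (realWindow_of_le_abs h0)⟩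

theorem contDiff_window : ContDiff ℝ ∞ window := by
  have h := contDiff_windowAngle
  have h' : ContDiff ℝ ∞ realWindow := by
    unfold realWindow
    exact (Real.contDiff_sin.comp h).mul (Real.contDiff_cos.comp (h.comp (by fun_prop)))
  exact Complex.ofRealCLM.contDiff.comp h'

theorem hasSum_window_sq {ξ : ℝ} (hξ : ξ ≠ 0) :
    HasSum (fun j : ℤ => ‖window ((2 : ℝ) ^ j * ξ)‖ ^ 2) 1 := by
  obtain ⟨n, hn₁, hn₂⟩ := exists_mem_Ioc_zpow (abs_pos.2 hξ) one_lt_two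
  have habs : ∀ j : ℤ, |(2 : ℝ) ^ j * ξ| = 2 ^ j * |ξ| := fun j => by
    rw [abs_mul, abs_of_pos (zpow_pos two_pos j)]
  have key : ∀ j : ℤ, (2 : ℝ) ^ (j + n) < |(2 : ℝ) ^ j * ξ| ∧
      |(2 : ℝ) ^ j * ξ| ≤ 2 ^ (j + n + 1) := fun j => by
    rw [habs, add_assoc, zpow_add₀ two_ne_zero, zpow_add₀ two_ne_zero j]
    have := zpow_pos (two_pos (α := ℝ)) j
    exact ⟨mul_lt_mul_of_pos_left hn₁ this, mul_le_mul_of_nonneg_left hn₂ this.le⟩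
  -- As `2 ^ n < |ξ| ≤ 2 ^ (n + 1)`, these two exponents bring `|ξ|` into `(1/8, 1/4]` and `(1/4,
  -- 1/2]`; all other dilates miss the support.
  have hsum : ∑ j ∈ {-3 - n, -2 - n}, ‖window ((2 : ℝ) ^ j * ξ)‖ ^ 2 = 1 := by
    rw [Finset.sum_pair (by omega)]
    have h2 : (2 : ℝ) ^ (-2 - n) * ξ = 2 * (2 ^ (-3 - n) * ξ) := by
      rw [show -2 - n = 1 + (-3 - n) by ring, zpow_add₀ two_ne_zero, zpow_one, mul_assoc]
    have hk := key (-3 - n)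
    rw [show -3 - n + n + 1 = (-2 : ℤ) by ring, show -3 - n + n = (-3 : ℤ) by ring] at hk
    rw [show (2 : ℝ) ^ (-3 : ℤ) = 1 / 8 by norm_num, show (2 : ℝ) ^ (-2 : ℤ) = 1 / 4 by norm_num] at hk
    rw [h2, window, window, Complex.norm_real, Complex.norm_real, Real.norm_eq_abs,
      Real.norm_eq_abs, sq_abs, sq_abs]
    exact realWindow_sq_add hk.1 hk.2
  rw [← hsum]
  refine hasSum_sum_of_ne_finset_zero fun j hj => ?_
  by_contra hne
  have hw := abs_mem_of_window_ne_zero (ξ := (2 : ℝ) ^ j * ξ) (fun h => hne (by simp [h]))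
  have hk := key j
  simp only [Finset.mem_insert, Finset.mem_singleton, not_or] at hj
  rcases lt_or_ge (j + n) (-3) with h | h
  · have : (2 : ℝ) ^ (j + n + 1) ≤ 2 ^ (-3 : ℤ) := zpow_le_zpow_right₀ one_le_two (by omega)
    norm_num at this
    linarith [hw.1, hk.2]
  · have : (2 : ℝ) ^ (-1 : ℤ) ≤ 2 ^ (j + n) := zpow_le_zpow_right₀ one_le_two (by omega)
    norm_num at this
    linarith [hw.2, hk.1]

theorem isFrazierJawerth_window : IsFrazierJawerth window where
  smooth := contDiff_window
  support_subset ξ hξ := by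
    obtain ⟨h₁, h₂⟩ := abs_mem_of_window_ne_zero hξ
    rcases le_total 0 ξ with h | h
    · rw [abs_of_nonneg h] at h₁ h₂
      exact Or.inr ⟨h₁.le, by linarith⟩
    · rw [abs_of_nonpos h] at h₁ h₂
      exact Or.inl ⟨by linarith, by linarith⟩
  sum_sq _ hξ := hasSum_window_sq hξ
  sum_odd ξ q hq := by
    -- Every term vanishes: the two arguments differ by `2 ^ j * |q| ≥ 1`, but both lie in `(-7/16,
    -- 7/16)` if neither factor is zero.
    convert hasSum_zero (α := ℂ) (β := ℕ) using 2 with j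
    by_contra hne
    rw [mul_eq_zero, not_or, map_eq_zero] at hne
    obtain ⟨-, h₁⟩ := abs_mem_of_window_ne_zero hne.1
    obtain ⟨-, h₂⟩ := abs_mem_of_window_ne_zero hne.2
    have h₃ : (1 : ℝ) ≤ |(q : ℝ)| := by
      have : q ≠ 0 := by rintro rfl; simp at hq
      exact_mod_cast Int.one_le_abs this
    have h₄ : |(q : ℝ)| ≤ |(2 : ℝ) ^ j * q| := by
      rw [abs_mul, abs_of_pos (a := (2 : ℝ) ^ j) (by positivity)]
      exact le_mul_of_one_le_left (abs_nonneg _) (one_le_pow₀ one_le_two)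
    have h₅ := abs_sub ((2 : ℝ) ^ j * (ξ + q)) (2 ^ j * ξ)
    rw [show (2 : ℝ) ^ j * (ξ + q) - 2 ^ j * ξ = 2 ^ j * q by ring] at h₅
    linarith

/-! ### Affine systems on the frequency side -/

open Complex in
/-- The Fourier transform of `x ↦ √T ψ (T x - z)`, in terms of the Fourier transform `h` of `ψ`. -/
def affineSymbol (h : ℝ → ℂ) (T z : ℝ) (ξ : ℝ) : ℂ :=
  ((Real.sqrt T)⁻¹ : ℝ) * (exp (((-(2 * Real.pi * (z * (T⁻¹ * ξ))) : ℝ) : ℂ) * I) * h (T⁻¹ * ξ))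

theorem contDiff_affineSymbol {h : ℝ → ℂ} (hs : ContDiff ℝ ∞ h) (T z : ℝ) :
    ContDiff ℝ ∞ (affineSymbol h T z) := by
  have h₁ : ContDiff ℝ ∞ fun ξ : ℝ => -(2 * Real.pi * (z * (T⁻¹ * ξ))) := by fun_prop
  exact contDiff_const.mul ((((Complex.ofRealCLM.contDiff.comp h₁).mul contDiff_const).cexp).mul
    (hs.comp (by fun_prop)))

theorem hasCompactSupport_affineSymbol {h : ℝ → ℂ} (hc : HasCompactSupport h) {T : ℝ} (hT : 0 < T)
    (z : ℝ) : HasCompactSupport (affineSymbol h T z) :=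
  (hc.comp_homeomorph (Homeomorph.mulLeft₀ T⁻¹ (inv_ne_zero hT.ne'))).mul_left.mul_left

theorem fourierInv_affineSymbol (h : ℝ → ℂ) {T : ℝ} (hT : 0 < T) (z x : ℝ) :
    𝓕⁻ (affineSymbol h T z) x = Real.sqrt T * 𝓕⁻ h (T * x - z) := by
  rw [Real.fourierInv_eq', Real.fourierInv_eq']
  have key : ∀ v : ℝ,
      Complex.exp (((2 * Real.pi * inner ℝ v x : ℝ) : ℂ) * Complex.I) • affineSymbol h T z v =
      ((Real.sqrt T)⁻¹ : ℝ) * (fun ξ : ℝ =>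
        Complex.exp (((2 * Real.pi * inner ℝ ξ (T * x - z) : ℝ) : ℂ) * Complex.I) • h ξ)
        (T⁻¹ * v) := fun v => by
    simp only [affineSymbol, smul_eq_mul, RCLike.inner_apply, conj_trivial]
    rw [mul_left_comm, ← mul_assoc (Complex.exp _), ← Complex.exp_add, ← add_mul,
      ← Complex.ofReal_add]
    congr 5
    field_simp
    ring
  simp_rw [key]
  rw [integral_const_mul, Measure.integral_comp_inv_mul_left (fun ξ : ℝ =>
    Complex.exp (((2 * Real.pi * inner ℝ ξ (T * x - z) : ℝ) : ℂ) * Complex.I) • h ξ), abs_of_pos hT, Complex.real_smul,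
    ← mul_assoc, ← Complex.ofReal_mul]
  congr 2
  nth_rw 2 [← Real.mul_self_sqrt hT.le]
  rw [inv_mul_cancel_left₀ (Real.sqrt_pos.2 hT).ne']

theorem coeFn_dilation {a : ℝ} (ha : a ≠ 0) (f : L2R) :
    (dilation a ha f : ℝ → ℂ) =ᵐ[volume] fun x => (Real.sqrt |a| : ℂ) * f (a * x) :=
  (memLp_dilation ha f).coeFn_toLp

theorem coeFn_translation (α : ℝ) (f : L2R) :
    (translation α f : ℝ → ℂ) =ᵐ[volume] fun x => f (x - α) :=
  Lp.coeFn_compMeasurePreserving _ _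

theorem quasiMeasurePreserving_const_mul {a : ℝ} (ha : a ≠ 0) :
    Measure.QuasiMeasurePreserving (fun x : ℝ => a * x) volume volume := by
  refine ⟨measurable_const_mul _, ?_⟩
  rw [Real.map_volume_mul_left ha]
  exact Measure.smul_absolutelyContinuous

theorem coeFn_affineSystem {ψ : L2R} {φ : ℝ → ℂ} (h : ψ =ᵐ[volume] φ) (p : ℤ × ℤ) :
    (affineSystem ψ p : ℝ → ℂ) =ᵐ[volume] fun x =>
      (Real.sqrt (2 ^ p.1) : ℂ) * φ ((2 : ℝ) ^ p.1 * x - p.2) := by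
  have hT : (0 : ℝ) < 2 ^ p.1 := zpow_pos two_pos p.1
  have h₁ := (coeFn_translation (p.2 : ℝ) ψ).trans
    ((measurePreserving_sub_right volume (p.2 : ℝ)).quasiMeasurePreserving.ae_eq_comp h)
  filter_upwards [coeFn_dilation hT.ne' (translation (p.2 : ℝ) ψ),
    (quasiMeasurePreserving_const_mul hT.ne').ae_eq_comp h₁] with x hx₁ hx₂
  rw [affineSystem, hx₁, abs_of_pos hT]
  exact congrArg _ hx₂

/-- Both sides come from Schwartz functions, where the `L²` inverse transform is the integral
computed in `fourierInv_affineSymbol`. -/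
theorem affineSystem_fourierInv {h : ℝ → ℂ} (hs : ContDiff ℝ ∞ h) (hc : HasCompactSupport h)
    (p : ℤ × ℤ) :
    affineSystem (𝓕⁻ ((hc.toSchwartzMap hs).toLp 2)) p =
      𝓕⁻ (((hasCompactSupport_affineSymbol hc (zpow_pos two_pos p.1) p.2).toSchwartzMap
        (contDiff_affineSymbol hs _ _)).toLp 2) := by
  rw [SchwartzMap.toLp_fourierInv_eq, SchwartzMap.toLp_fourierInv_eq]
  generalize hσ : (hasCompactSupport_affineSymbol hc (zpow_pos two_pos p.1) p.2).toSchwartzMap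
        (contDiff_affineSymbol hs _ _) = σ
  have hσ' : (σ : ℝ → ℂ) = affineSymbol h (2 ^ p.1) p.2 := by rw [← hσ]; rfl
  generalize hη : hc.toSchwartzMap hs = η
  have hη' : (η : ℝ → ℂ) = h := by rw [← hη]; rfl
  apply Lp.ext
  filter_upwards [coeFn_affineSystem (SchwartzMap.coeFn_toLp (𝓕⁻ η) 2 volume) p,
    SchwartzMap.coeFn_toLp (𝓕⁻ σ) 2 volume] with x hx₁ hx₂
  rw [hx₁, hx₂, SchwartzMap.fourierInv_coe, SchwartzMap.fourierInv_coe, hσ', hη',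
    fourierInv_affineSymbol h (zpow_pos two_pos p.1)]

open Complex in
theorem inner_affineSystem_fourierInv {h : ℝ → ℂ} (hs : ContDiff ℝ ∞ h) (hc : HasCompactSupport h)
    (p : ℤ × ℤ) (f : L2R) :
    inner ℂ (affineSystem (𝓕⁻ ((hc.toSchwartzMap hs).toLp 2)) p) f =
      ((Real.sqrt (2 ^ p.1))⁻¹ : ℝ) * ∫ ξ : ℝ,
        exp (((2 * Real.pi * (p.2 * (((2 : ℝ) ^ p.1)⁻¹ * ξ)) : ℝ) : ℂ) * I) *
          ((𝓕 f : L2R) ξ * conj (h (((2 : ℝ) ^ p.1)⁻¹ * ξ))) := by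
  rw [affineSystem_fourierInv, ← Lp.inner_fourier_eq, FourierTransform.fourier_fourierInv_eq,
    L2.inner_def, ← integral_const_mul]
  refine integral_congr_ae ?_
  filter_upwards [SchwartzMap.coeFn_toLp (((hasCompactSupport_affineSymbol hc
    (zpow_pos two_pos p.1) p.2).toSchwartzMap (contDiff_affineSymbol hs _ _))) 2 volume] with ξ hξ
  rw [hξ]
  rw [show ∀ e : SchwartzMap ℝ ℂ, inner ℂ (e ξ) ((𝓕 f : L2R) ξ) = (𝓕 f : L2R) ξ * conj (e ξ) from
    fun _ => rfl, HasCompactSupport.toSchwartzMap_toFun, affineSymbol, map_mul, map_mul,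
    ← exp_conj, map_mul, conj_ofReal, conj_ofReal, conj_I, ofReal_neg, neg_mul_neg]
  ring

/-! ### Parseval and orthogonality on one period -/

/-- The Fourier coefficient of `K` at frequency `-z / T`, with respect to the functions
`ξ ↦ e^{-2πi z ξ / T} / √T`. -/
def periodicCoeff (T : ℝ) (K : ℝ → ℂ) (z : ℤ) : ℂ :=
  ((Real.sqrt T)⁻¹ : ℝ) * ∫ ξ : ℝ,
    Complex.exp (((2 * Real.pi * (z * (T⁻¹ * ξ)) : ℝ) : ℂ) * Complex.I) * K ξ

/-- Parseval's identity on a period. -/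
theorem hasSum_sq_periodicCoeff {T : ℝ} (hT : 0 < T) {K : ℝ → ℂ} (hK : MemLp K 2 volume)
    (hsupp : Function.support K ⊆ Set.Ioc (-(T / 2)) (T / 2)) :
    HasSum (fun z : ℤ => ‖periodicCoeff T K z‖ ^ 2) (∫ ξ, ‖K ξ‖ ^ 2) := by
  have hab : -(T / 2) < T / 2 := by linarith
  have hba : T / 2 - -(T / 2) = T := by ring
  have h := hasSum_sq_fourierCoeffOn hab (hK.restrict _)
  -- `fourierCoeffOn` carries the opposite sign in the exponent and the factor `T⁻¹` instead of `T ^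
  -- (-1/2)`: hence the reindexing, and the multiplication by `T` below.
  rw [← (Equiv.neg ℤ).hasSum_iff] at h
  have h' := h.mul_left T
  have hint : (∫ x in (-(T / 2))..(T / 2), ‖K x‖ ^ 2) = ∫ ξ, ‖K ξ‖ ^ 2 :=
    intervalIntegral.integral_eq_integral_of_support_subset fun x hx =>
      hsupp fun h0 => hx (by simp [h0])
  rw [hba, hint, smul_eq_mul, mul_inv_cancel_left₀ hT.ne'] at h'
  refine HasSum.congr_fun h' fun z => ?_
  have hcoeff : fourierCoeffOn hab K (-z) = (T⁻¹ : ℝ) • ∫ ξ : ℝ,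
      Complex.exp (((2 * Real.pi * (z * (T⁻¹ * ξ)) : ℝ) : ℂ) * Complex.I) * K ξ := by
    rw [fourierCoeffOn_eq_integral, intervalIntegral.integral_eq_integral_of_support_subset
      fun x hx => hsupp fun h0 => hx (by simp [h0]), hba, one_div, neg_neg]
    congr 2 with ξ
    rw [fourier_coe_apply, smul_eq_mul]
    congr 2
    push_cast
    ring
  rw [Function.comp_apply, Equiv.neg_apply, hcoeff, periodicCoeff, norm_mul, norm_smul, mul_pow,
    mul_pow, ← mul_assoc, Complex.norm_real, Real.norm_eq_abs, Real.norm_eq_abs, sq_abs, sq_abs,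
    inv_pow, Real.sq_sqrt hT.le]
  congr 1
  field_simp

theorem integrable_exp_mul_of_support_subset {T : ℝ} {K : ℝ → ℂ} (hK : MemLp K 2 volume)
    (hsupp : Function.support K ⊆ Set.Ioc (-(T / 2)) (T / 2)) (z : ℤ) :
    Integrable fun ξ : ℝ =>
      Complex.exp (((2 * Real.pi * (z * (T⁻¹ * ξ)) : ℝ) : ℂ) * Complex.I) * K ξ := by
  have h : Integrable K :=
    (integrableOn_iff_integrable_of_support_subset hsupp).1 ((hK.restrict _).integrable one_le_two)
  refine h.bdd_mul (c := 1) (by fun_prop) (Filter.Eventually.of_forall fun ξ => ?_)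
  rw [Complex.norm_exp_ofReal_mul_I]

theorem periodicCoeff_add_const_mul {T : ℝ} {K L : ℝ → ℂ} (hK : MemLp K 2 volume)
    (hL : MemLp L 2 volume) (hKs : Function.support K ⊆ Set.Ioc (-(T / 2)) (T / 2))
    (hLs : Function.support L ⊆ Set.Ioc (-(T / 2)) (T / 2)) (c : ℂ) (z : ℤ) :
    periodicCoeff T (fun ξ => K ξ + c * L ξ) z = periodicCoeff T K z + c * periodicCoeff T L z := by
  simp only [periodicCoeff]
  rw [mul_left_comm c, ← mul_add, ← integral_const_mul c, ← integral_add
    (integrable_exp_mul_of_support_subset hK hKs z)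
    ((integrable_exp_mul_of_support_subset hL hLs z).const_mul c)]
  congr 2 with ξ
  ring

/-- The coefficient sequences of functions with disjoint supports are orthogonal. -/
theorem hasSum_periodicCoeff_mul_conj {T : ℝ} (hT : 0 < T) {K L : ℝ → ℂ} (hK : MemLp K 2 volume)
    (hL : MemLp L 2 volume) (hKs : Function.support K ⊆ Set.Ioc (-(T / 2)) (T / 2))
    (hLs : Function.support L ⊆ Set.Ioc (-(T / 2)) (T / 2)) (hKL : ∀ ξ, K ξ = 0 ∨ L ξ = 0) :
    HasSum (fun z : ℤ => periodicCoeff T L z * conj (periodicCoeff T K z)) 0 := by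
  -- Polarization: Parseval for `K + c * L`, minus Parseval for `K` and for `L`, leaves only the
  -- cross term, because disjoint supports make the energies add. The choices `c = 1` and `c = I`
  -- give the real part and minus the imaginary part.
  have key : ∀ c : ℂ, ‖c‖ = 1 →
      HasSum (fun z : ℤ => (c * (periodicCoeff T L z * conj (periodicCoeff T K z))).re) 0 := by
    intro c hc
    have hsum := hasSum_sq_periodicCoeff hT (K := fun ξ => K ξ + c * L ξ)
      (hK.add (hL.const_mul c)) (fun ξ hξ => by
        by_contra hn
        have h₁ : K ξ = 0 := by_contra fun h => hn (hKs h)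
        have h₂ : L ξ = 0 := by_contra fun h => hn (hLs h)
        exact hξ (by simp [h₁, h₂]))
    have hint : (∫ ξ, ‖K ξ + c * L ξ‖ ^ 2) = (∫ ξ, ‖K ξ‖ ^ 2) + ∫ ξ, ‖L ξ‖ ^ 2 := by
      rw [← integral_add ((memLp_two_iff_integrable_sq_norm hK.1).1 hK)
        ((memLp_two_iff_integrable_sq_norm hL.1).1 hL)]
      congr 1 with ξ
      rcases hKL ξ with h | h <;> simp [h, hc]
    rw [hint] at hsum
    have h := ((hsum.sub (hasSum_sq_periodicCoeff hT hK hKs)).sub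
      (hasSum_sq_periodicCoeff hT hL hLs)).mul_left (1 / 2)
    rw [add_sub_cancel_left, sub_self, mul_zero] at h
    refine HasSum.congr_fun h fun z => ?_
    rw [periodicCoeff_add_const_mul hK hL hKs hLs, Complex.sq_norm, Complex.sq_norm,
      Complex.sq_norm, Complex.normSq_add, Complex.normSq_mul, ← Complex.sq_norm c, hc,
      ← Complex.conj_re (c * _)]
    simp only [map_mul, Complex.conj_conj]
    rw [← mul_assoc, mul_comm _ (periodicCoeff T K z)]
    ring
  rw [Complex.hasSum_iff]
  refine ⟨by simpa using key 1 (by simp), ?_⟩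
  have h := (key Complex.I (by simp)).neg
  rw [neg_zero] at h
  exact h.congr_fun fun z => by simp

/-! ### Tight frames and strong disjointness for band-limited test functions -/

/-- The function in `L²(ℝ)` whose Fourier transform is the test function `h`. -/
def fourierInvOfTest {h : ℝ → ℂ} (hs : ContDiff ℝ ∞ h) (hc : HasCompactSupport h) : L2R :=
  𝓕⁻ ((hc.toSchwartzMap hs).toLp 2)

theorem fourier_fourierInvOfTest {h : ℝ → ℂ} (hs : ContDiff ℝ ∞ h) (hc : HasCompactSupport h) :
    (𝓕 (fourierInvOfTest hs hc) : L2R) =ᵐ[volume] h := by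
  rw [fourierInvOfTest, FourierTransform.fourier_fourierInv_eq]
  exact SchwartzMap.coeFn_toLp _ 2 volume

/-- The frequency-side product whose periodic coefficients are the analysis coefficients of `f`
at scale `T`. -/
def localizedProduct (h : ℝ → ℂ) (T : ℝ) (f : L2R) (ξ : ℝ) : ℂ :=
  (𝓕 f : L2R) ξ * conj (h (T⁻¹ * ξ))

theorem memLp_localizedProduct {h : ℝ → ℂ} (hcont : Continuous h) (hc : HasCompactSupport h)
    (T : ℝ) (f : L2R) : MemLp (localizedProduct h T f) 2 volume := by
  obtain ⟨C, hC⟩ := hc.exists_bound_of_continuous hcont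
  have hF := Lp.memLp (𝓕 f : L2R)
  refine hF.of_le_mul (c := C) (hF.1.mul (by fun_prop)) (Filter.Eventually.of_forall fun ξ => ?_)
  rw [localizedProduct, norm_mul, mul_comm, RCLike.norm_conj]
  exact mul_le_mul_of_nonneg_right (hC _) (norm_nonneg _)

theorem support_localizedProduct_subset {h : ℝ → ℂ}
    (hsupp : Function.support h ⊆ Set.Ioc (-(1 / 2)) (1 / 2)) {T : ℝ} (hT : 0 < T) (f : L2R) :
    Function.support (localizedProduct h T f) ⊆ Set.Ioc (-(T / 2)) (T / 2) := by
  intro ξ hξ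
  have hne : h (T⁻¹ * ξ) ≠ 0 := fun h0 => hξ (by simp [localizedProduct, h0])
  obtain ⟨h₁, h₂⟩ := hsupp hne
  rw [inv_mul_eq_div, lt_div_iff₀ hT] at h₁
  rw [inv_mul_eq_div, div_le_iff₀ hT] at h₂
  exact ⟨by linarith, by linarith⟩

theorem inner_affineSystem_fourierInvOfTest {h : ℝ → ℂ} (hs : ContDiff ℝ ∞ h)
    (hc : HasCompactSupport h) (m z : ℤ) (f : L2R) :
    inner ℂ (affineSystem (fourierInvOfTest hs hc) (m, z)) f =
      periodicCoeff (2 ^ m) (localizedProduct h (2 ^ m) f) z :=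
  inner_affineSystem_fourierInv hs hc (m, z) f

theorem integral_norm_sq_fourier (f : L2R) : ∫ ξ, ‖(𝓕 f : L2R) ξ‖ ^ 2 = ‖f‖ ^ 2 := by
  rw [← Lp.norm_fourier_eq, ← inner_self_eq_norm_sq (𝕜 := ℂ), L2.inner_def, ← integral_re
    (L2.integrable_inner _ _)]
  simp_rw [inner_self_eq_norm_sq]

theorem hasSum_integral_localizedProduct {h : ℝ → ℂ} (hcont : Continuous h)
    (hsum : ∀ ξ : ℝ, ξ ≠ 0 → HasSum (fun j : ℤ => ‖h ((2 : ℝ) ^ j * ξ)‖ ^ 2) 1) (f : L2R) :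
    HasSum (fun m : ℤ => ∫ ξ, ‖localizedProduct h (2 ^ m) f ξ‖ ^ 2) (‖f‖ ^ 2) := by
  have hF := Lp.memLp (𝓕 f : L2R)
  have hpt : ∀ᵐ ξ : ℝ, HasSum (fun m : ℤ => ‖localizedProduct h (2 ^ m) f ξ‖ ^ 2)
      (‖(𝓕 f : L2R) ξ‖ ^ 2) := by
    filter_upwards [Measure.ae_ne volume (0 : ℝ)] with ξ hξ
    -- Scale `m` evaluates `h` at `2 ^ (-m) * ξ`, so the square sum is reindexed by `m ↦ -m`.
    have h₁ := ((Equiv.neg ℤ).hasSum_iff.mpr (hsum ξ hξ)).mul_left (‖(𝓕 f : L2R) ξ‖ ^ 2)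
    rw [mul_one] at h₁
    refine HasSum.congr_fun h₁ fun m => ?_
    rw [localizedProduct, norm_mul, RCLike.norm_conj, mul_pow, Function.comp_apply,
      Equiv.neg_apply, zpow_neg]
  rw [← integral_norm_sq_fourier]
  -- The terms are nonnegative and serve as their own bounds; their pointwise sum `‖𝓕 f‖ ^ 2` is
  -- integrable.
  refine hasSum_integral_of_dominated_convergence
    (fun m ξ => ‖localizedProduct h (2 ^ m) f ξ‖ ^ 2) (fun m => ?_) (fun m => ?_) ?_ ?_ hpt
  · exact ((hF.1.mul (by fun_prop)).norm.pow 2)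
  · exact Filter.Eventually.of_forall fun ξ => by rw [Real.norm_of_nonneg (sq_nonneg _)]
  · exact hpt.mono fun ξ hξ => hξ.summable
  · refine ((memLp_two_iff_integrable_sq_norm hF.1).1 hF).congr ?_
    exact hpt.mono fun ξ hξ => hξ.tsum_eq.symm

theorem isNormalizedTightFrameWavelet_fourierInvOfTest {h : ℝ → ℂ} (hs : ContDiff ℝ ∞ h)
    (hc : HasCompactSupport h) (hsupp : Function.support h ⊆ Set.Ioc (-(1 / 2)) (1 / 2))
    (hsum : ∀ ξ : ℝ, ξ ≠ 0 → HasSum (fun j : ℤ => ‖h ((2 : ℝ) ^ j * ξ)‖ ^ 2) 1) :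
    IsNormalizedTightFrameWavelet (fourierInvOfTest hs hc) := by
  intro f
  have hfib : ∀ m : ℤ, HasSum
      (fun z : ℤ => ‖inner ℂ (affineSystem (fourierInvOfTest hs hc) (m, z)) f‖ ^ 2)
      (∫ ξ, ‖localizedProduct h (2 ^ m) f ξ‖ ^ 2) := fun m => by
    simp_rw [inner_affineSystem_fourierInvOfTest]
    exact hasSum_sq_periodicCoeff (zpow_pos two_pos m) (memLp_localizedProduct hs.continuous hc _ f)
      (support_localizedProduct_subset hsupp (zpow_pos two_pos m) f)
  have htot := hasSum_integral_localizedProduct hs.continuous hsum f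
  have hs' : Summable fun p : ℤ × ℤ =>
      ‖inner ℂ (affineSystem (fourierInvOfTest hs hc) p) f‖ ^ 2 := by
    refine (summable_prod_of_nonneg fun p => sq_nonneg _).mpr ⟨fun m => (hfib m).summable, ?_⟩
    simpa only [fun m => (hfib m).tsum_eq] using htot.summable
  rw [← (hs'.hasSum.prod_fiberwise hfib).unique htot]
  exact hs'.hasSum

theorem stronglyDisjoint_affineSystem_fourierInvOfTest {h₁ h₂ : ℝ → ℂ} (hs₁ : ContDiff ℝ ∞ h₁)
    (hc₁ : HasCompactSupport h₁) (hs₂ : ContDiff ℝ ∞ h₂) (hc₂ : HasCompactSupport h₂)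
    (hsupp₁ : Function.support h₁ ⊆ Set.Ioc (-(1 / 2)) (1 / 2))
    (hsupp₂ : Function.support h₂ ⊆ Set.Ioc (-(1 / 2)) (1 / 2))
    (hdisj : ∀ ξ, h₁ ξ = 0 ∨ h₂ ξ = 0)
    (hb₁ : IsBessel (affineSystem (fourierInvOfTest hs₁ hc₁)))
    (hb₂ : IsBessel (affineSystem (fourierInvOfTest hs₂ hc₂))) :
    StronglyDisjoint (affineSystem (fourierInvOfTest hs₁ hc₁))
      (affineSystem (fourierInvOfTest hs₂ hc₂)) := by
  refine ⟨hb₁, hb₂, Submodule.isOrtho_iff_inner_eq.mpr ?_⟩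
  rintro _ ⟨f₁, rfl⟩ _ ⟨f₂, rfl⟩
  -- The inner product converges over all pairs `(m, z)`, so it is enough that the sum over `z`
  -- vanishes for each fixed `m`.
  refine ((lp.hasSum_inner _ _).prod_fiberwise (g := fun _ => 0) fun m => ?_).unique hasSum_zero
  have hT : (0 : ℝ) < 2 ^ m := zpow_pos two_pos m
  refine HasSum.congr_fun (hasSum_periodicCoeff_mul_conj hT
    (memLp_localizedProduct hs₁.continuous hc₁ _ f₁)
    (memLp_localizedProduct hs₂.continuous hc₂ _ f₂)
    (support_localizedProduct_subset hsupp₁ hT f₁)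
    (support_localizedProduct_subset hsupp₂ hT f₂) fun ξ => ?_) fun z => ?_
  · exact (hdisj ((2 ^ m)⁻¹ * ξ)).imp (fun h => by simp [localizedProduct, h])
      fun h => by simp [localizedProduct, h]
  · rw [← inner_affineSystem_fourierInvOfTest hs₁ hc₁, ← inner_affineSystem_fourierInvOfTest hs₂ hc₂]
    rfl

/-! ### Dilates of the window by powers of four -/

/-- The dilates `ξ ↦ window (4 ^ k ξ)`. -/
def dilatedWindow (k : ℕ) (ξ : ℝ) : ℂ := window ((4 : ℝ) ^ k * ξ)

theorem contDiff_dilatedWindow (k : ℕ) : ContDiff ℝ ∞ (dilatedWindow k) :=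
  contDiff_window.comp (by fun_prop)

theorem support_dilatedWindow_subset (k : ℕ) :
    Function.support (dilatedWindow k) ⊆ Set.Ioc (-(1 / 2)) (1 / 2) := by
  intro ξ hξ
  have h₁ := (abs_mem_of_window_ne_zero hξ).2
  have h₂ : |ξ| ≤ |(4 : ℝ) ^ k * ξ| := by
    rw [abs_mul, abs_of_pos (a := (4 : ℝ) ^ k) (by positivity)]
    exact le_mul_of_one_le_left (abs_nonneg _) (one_le_pow₀ (by norm_num))
  have h₃ := abs_lt.1 (h₂.trans_lt h₁)
  exact ⟨by linarith [h₃.1], by linarith [h₃.2]⟩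

theorem hasCompactSupport_dilatedWindow (k : ℕ) : HasCompactSupport (dilatedWindow k) :=
  HasCompactSupport.of_support_subset_isCompact isCompact_Icc
    ((support_dilatedWindow_subset k).trans Set.Ioc_subset_Icc_self)

theorem hasSum_dilatedWindow_sq (k : ℕ) {ξ : ℝ} (hξ : ξ ≠ 0) :
    HasSum (fun j : ℤ => ‖dilatedWindow k ((2 : ℝ) ^ j * ξ)‖ ^ 2) 1 := by
  simp only [dilatedWindow, mul_left_comm ((4 : ℝ) ^ k)]
  exact hasSum_window_sq (mul_ne_zero (by positivity) hξ)

/-- A nonzero value at level `k` forces `4 ^ k * |ξ| > 1/8`, hence `4 ^ l * |ξ| > 1/2`, beyond the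
bound `7/16` of the support. -/
theorem dilatedWindow_eq_zero_of_lt {k l : ℕ} (hkl : k < l) {ξ : ℝ} (h : dilatedWindow k ξ ≠ 0) :
    dilatedWindow l ξ = 0 := by
  by_contra h'
  have h₁ := (abs_mem_of_window_ne_zero h).1
  have h₂ := (abs_mem_of_window_ne_zero h').2
  have h₃ : (4 : ℝ) ^ (k + 1) ≤ 4 ^ l := pow_le_pow_right₀ (by norm_num) hkl
  rw [abs_mul, abs_of_pos (a := (4 : ℝ) ^ _) (by positivity)] at h₁ h₂
  have h₄ := mul_le_mul_of_nonneg_right h₃ (abs_nonneg ξ)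
  rw [pow_succ] at h₄
  linarith

theorem dilatedWindow_eq_zero_or {k l : ℕ} (hkl : k ≠ l) (ξ : ℝ) :
    dilatedWindow k ξ = 0 ∨ dilatedWindow l ξ = 0 := by
  rcases hkl.lt_or_gt with h | h
  · exact or_iff_not_imp_left.mpr (dilatedWindow_eq_zero_of_lt h)
  · exact or_iff_not_imp_right.mpr (dilatedWindow_eq_zero_of_lt h)

/-- The wavelet with Fourier transform `dilatedWindow k`. -/
def windowWavelet (k : ℕ) : L2R :=
  fourierInvOfTest (contDiff_dilatedWindow k) (hasCompactSupport_dilatedWindow k)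

theorem fourier_windowWavelet (k : ℕ) :
    (𝓕 (windowWavelet k) : L2R) =ᵐ[volume] fun ξ : ℝ => window ((4 : ℝ) ^ k * ξ) :=
  fourier_fourierInvOfTest (contDiff_dilatedWindow k) (hasCompactSupport_dilatedWindow k)

theorem isNormalizedTightFrameWavelet_windowWavelet (k : ℕ) :
    IsNormalizedTightFrameWavelet (windowWavelet k) :=
  isNormalizedTightFrameWavelet_fourierInvOfTest _ _ (support_dilatedWindow_subset k)
    fun _ => hasSum_dilatedWindow_sq k

theorem stronglyDisjoint_windowWavelet {k l : ℕ} (hkl : k ≠ l) :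
    StronglyDisjoint (affineSystem (windowWavelet k)) (affineSystem (windowWavelet l)) :=
  stronglyDisjoint_affineSystem_fourierInvOfTest _ _ _ _ (support_dilatedWindow_subset k)
    (support_dilatedWindow_subset l) (dilatedWindow_eq_zero_or hkl)
    (isNormalizedTightFrameWavelet_windowWavelet k).isBessel
    (isNormalizedTightFrameWavelet_windowWavelet l).isBessel

end

end WaveletFrames

theorem mainTheorem8 :
    ∃ (g₀ : ℝ → ℂ) (ψ₀ : WaveletFrames.L2R),
      WaveletFrames.IsFrazierJawerth g₀ ∧
      (𝓕 ψ₀ : WaveletFrames.L2R) =ᵐ[volume] g₀ ∧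
      WaveletFrames.IsNormalizedTightFrameWavelet ψ₀ ∧
      ∀ N : ℕ, ∃ ψ : Fin N → WaveletFrames.L2R,
        (∀ n : Fin N,
          (𝓕 (ψ n) : WaveletFrames.L2R) =ᵐ[volume]
            (fun ξ : ℝ => g₀ ((4 : ℝ) ^ ((n : ℕ) + 1) * ξ)) ∧
          WaveletFrames.IsNormalizedTightFrameWavelet (ψ n) ∧
          WaveletFrames.HasSmoothCompactFourier (ψ n)) ∧
        ∀ i j : Fin N, i ≠ j →
          WaveletFrames.StronglyDisjoint
            (WaveletFrames.affineSystem (ψ i)) (WaveletFrames.affineSystem (ψ j)) := by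
  refine ⟨WaveletFrames.window, WaveletFrames.windowWavelet 0,
    WaveletFrames.isFrazierJawerth_window, by simpa using WaveletFrames.fourier_windowWavelet 0,
    WaveletFrames.isNormalizedTightFrameWavelet_windowWavelet 0, fun N =>
    -- `Fin N` starts at `0`, while the wavelets are numbered from `1`.
    ⟨fun n => WaveletFrames.windowWavelet (n + 1), fun n =>
      ⟨WaveletFrames.fourier_windowWavelet (n + 1),
        WaveletFrames.isNormalizedTightFrameWavelet_windowWavelet (n + 1),
        WaveletFrames.dilatedWindow (n + 1), WaveletFrames.contDiff_dilatedWindow (n + 1),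
        WaveletFrames.hasCompactSupport_dilatedWindow (n + 1),
        WaveletFrames.fourier_windowWavelet (n + 1)⟩,
      fun i j hij => WaveletFrames.stronglyDisjoint_windowWavelet fun h => hij ?_⟩⟩
  exact Fin.ext (Nat.succ_injective h)
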